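/- **Setting.** Let $\mathcal X$ be a set, $\mathcal Y\subset\mathbb R$ nonempty and compact, $\Delta_{\mathcal Y}$ the set of Borel probability measures on $\mathcal Y$, $\mathcal T$ a real vector space, $L\ge 0$ and $n\ge 0$. Let $\ell:\mathbb R\times\mathbb R\to\mathbb R$ be such that, for every $y\in\mathcal Y$, $\ell(\cdot,y)$ is convex on $\mathbb R$ and $L$-Lipschitz over $\mathcal Y$, and for $\hat y,y\in\mathcal Y$ let $\partial\ell(\hat y,y)\in[-L,L]$ be a fixed choice of a subderivative of $\ell(\cdot,y)$ at $\hat y$. Assume that for every probability distribution $p$ on $\mathcal Y$ for which $\mathbb E_{y\sim p}\,\ell(z,y)$ is defined for all $z\in\mathbb R$, the function $z\mapsto \mathbb E_{y\sim p}\,\ell(z,y)$ on $\mathbb R$ has a minimizer $\hat y^\star\in\mathcal Y$ such that either $\ell(\cdot,y)$ is differentiable at $\hat y^\star$ for $p$-almost every $y$, or $\mathbb E_{y\sim p}\,\partial\ell(\hat y^\star,y)=0$. (If $\ell$ is differentiable in its first argument, this only says that some minimizer lies in $\mathcal Y$.) Let $\phi:\mathcal X^n\times\mathcal Y^n\to\mathbb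 R$ be given and let $(\mathbf T,V)$, with $\mathbf T:\mathcal X\times\mathcal Y\times[-L,L]\to\mathcal T$ and $V:\mathcal T\to\mathbb R$, be a sufficient statistic pair for $\phi$: $$\sum_{t=1}^n\ell(\hat y_t,y_t)-\phi(x_1,y_1,\dots,x_n,y_n)\le V\Big(\sum_{t=1}^n\mathbf T(x_t,\hat y_t,\partial\ell(\hat y_t,y_t))\Big)$$ for all $x_t\in\mathcal X$ and $\hat y_t,y_t\in\mathcal Y$. Let $\mathbf U:\mathcal T\to\mathbb R$ be a Burkholder function for $(\mathbf T,V)$, that is: 1. $\mathbf U(0)\le 0$; 2. $\mathbf U(\tau)\ge V(\tau)$ for all $\tau\in\mathcal T$; 3. either, for all $\tau\in\mathcal T$, $z\in\mathcal X\times\mathcal Y$ and every mean-zero distribution $p$ on $[-L,L]$ for which the expectation is defined, $\mathbb E_{\alpha\sim p}\,\mathbf U(\tau+\mathbf T(z,\alpha))\le\mathbf U(\tau)$; or, for all $\tau,z$, the map $\alpha\mapsto\mathbf U(\tau+\mathbf T(z,\alpha))$ is convex on $[-L,L]$ and $\frac12\mathbf U(\tau+\mathbf T(z,L))+\frac12\mathbf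 U(\tau+\mathbf T(z,-L))\le\mathbf U(\tau)$. Assume that $\hat y\mapsto\mathbf U(\tau+\mathbf T(x,\hat y,\partial\ell(\hat y,y)))$ is lower semicontinuous on $\mathcal Y$ for all $\tau\in\mathcal T$, $x\in\mathcal X$, $y\in\mathcal Y$. **Algorithm.** For $\zeta\in\mathcal T$, $x\in\mathcal X$ and $q\in\Delta_{\mathcal Y}$ put $G_{\zeta,x}(q)=\sup_{y\in\mathcal Y}\mathbb E_{\hat y\sim q}\,\mathbf U(\zeta+\mathbf T(x,\hat y,\partial\ell(\hat y,y)))\in(-\infty,+\infty]$. A Burkholder algorithm is a rule $A$ that maps each $(\zeta,x)$ to a minimizer $A(\zeta,x)$ of $G_{\zeta,x}$ over $\Delta_{\mathcal Y}$. In round $t$ it samples $\hat y_t\sim q_t=A(\zeta_{t-1},x_t)$, where $\zeta_{t-1}=\sum_{j<t}\mathbf T(x_j,\hat y_j,\partial\ell(\hat y_j,y_j))$ is all that it stores of the past. **Claim.** For all $(\zeta,x)$ the minimum of $G_{\zeta,x}$ is attained, so that Burkholder algorithms exist. Every Burkholder algorithm $A$ satisfies, for every sequence $(x_1,y_1),\dots,(x_n,y_n)$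 in $\mathcal X\times\mathcal Y$, $$\mathbb E\Big[\sum_{t=1}^n\ell(\hat y_t,y_t)\Big]\le\phi(x_1,y_1,\dots,x_n,y_n).$$ This holds in both of the following senses. (a) For the iterated expectation $\mathbb E_{\hat y_1\sim q_1}\cdots\mathbb E_{\hat y_n\sim q_n}$, with no measurability assumption on $A$, each expectation being read as an upper expectation (the infimum of the expectations of the integrable majorants, which is the usual expectation for integrable functions). (b) For all random variables $\hat y_1,\dots,\hat y_n$ on any probability space such that, for each $t$, the conditional law of $\hat y_t$ given $\hat y_1,\dots,\hat y_{t-1}$ is almost surely $A(\zeta_{t-1},x_t)$; the cumulative loss is then integrable. -/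

import Mathlib

open TopologicalSpace MeasureTheory ProbabilityTheory

namespace OnlineLearning

noncomputable section

/-- The interval `[-L, L]` in which the (sub)derivatives of the loss take their values. -/
abbrev Slope (L : NNReal) : Type := Set.Icc (-(L : ℝ)) (L : ℝ)

/-- Assumptions on the loss `ℓ (ŷ, y)`: it is convex in the first argument, `L`-Lipschitz in the
first argument over `Y`, `d ŷ y ∈ [-L, L]` is a subderivative of `ℓ (·, y)` at `ŷ`, and every
distribution `p` on `Y` has an expected-loss minimizer over `ℝ` that lies in `Y`.

At that minimizer either the losses are differentiable (`p`-almost surely), or the selected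
subderivative `d` has `p`-mean zero. For a differentiable loss the first alternative always
holds, so that nothing is required beyond the existence of the minimizer in `Y`. -/
structure AdmissibleLoss (Y : NonemptyCompacts ℝ) (L : NNReal) (ℓ : ℝ → ℝ → ℝ)
    (d : Y → Y → Slope L) : Prop where
  convex : ∀ y : Y, ConvexOn ℝ Set.univ (fun z => ℓ z y)
  lipschitz : ∀ y : Y, LipschitzOnWith L (fun z => ℓ z y) (Y : Set ℝ)
  subderivative : ∀ (ŷ y : Y) (z : ℝ), ℓ ŷ y + (d ŷ y : ℝ) * (z - ŷ) ≤ ℓ z y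
  minimizer : ∀ p : ProbabilityMeasure Y,
    (∀ z : ℝ, Integrable (fun y : Y => ℓ z y) (p : Measure Y)) →
    ∃ ŷ : Y,
      (∀ z : ℝ, ∫ y : Y, ℓ ŷ y ∂(p : Measure Y) ≤ ∫ y : Y, ℓ z y ∂(p : Measure Y)) ∧
      ((∀ᵐ y : Y ∂(p : Measure Y), DifferentiableAt ℝ (fun z => ℓ z y) (ŷ : ℝ)) ∨
        (Integrable (fun y : Y => (d ŷ y : ℝ)) (p : Measure Y) ∧
          ∫ y : Y, (d ŷ y : ℝ) ∂(p : Measure Y) = 0))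

section Statistic

variable {X : Type*} {𝒯 : Type*} [AddCommGroup 𝒯] [Module ℝ 𝒯]
  {Y : NonemptyCompacts ℝ} {L : NNReal}

/-- `(T, V)` is a sufficient statistic pair for the benchmark `φ` over `n` rounds. -/
def IsSufficientPair {n : ℕ} (ℓ : ℝ → ℝ → ℝ) (d : Y → Y → Slope L)
    (φ : (Fin n → X) → (Fin n → Y) → ℝ) (T : X → Y → Slope L → 𝒯) (V : 𝒯 → ℝ) : Prop :=
  ∀ (x : Fin n → X) (ŷ y : Fin n → Y),
    ∑ t, ℓ (ŷ t) (y t) - φ x y ≤ V (∑ t, T (x t) (ŷ t) (d (ŷ t) (y t)))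

/-- Restricted concavity: `E_{α ∼ p} U (τ + T (z, α)) ≤ U τ` for every mean-zero distribution `p`
on `[-L, L]` for which the expectation is defined. -/
def RestrictedConcavity (T : X → Y → Slope L → 𝒯) (U : 𝒯 → ℝ) : Prop :=
  ∀ (τ : 𝒯) (x : X) (ŷ : Y) (p : ProbabilityMeasure (Slope L)),
    ∫ α : Slope L, (α : ℝ) ∂(p : Measure (Slope L)) = 0 →
    Integrable (fun α : Slope L => U (τ + T x ŷ α)) (p : Measure (Slope L)) →
    ∫ α : Slope L, U (τ + T x ŷ α) ∂(p : Measure (Slope L)) ≤ U τ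

/-- An end point of `[-L, L]`. -/
def slopeTop (L : NNReal) : Slope L := ⟨L, by simp⟩

/-- An end point of `[-L, L]`. -/
def slopeBot (L : NNReal) : Slope L := ⟨-L, by simp⟩

/-- The convex form of the third property: `α ↦ U (τ + T (z, α))` is convex on `[-L, L]`, and
`E_ε U (τ + T (z, ε L)) ≤ U τ` for a Rademacher sign `ε`. -/
def RademacherConcavity (T : X → Y → Slope L → 𝒯) (U : 𝒯 → ℝ) : Prop :=
  ∀ (τ : 𝒯) (x : X) (ŷ : Y),
    (∀ (α β γ : Slope L) (a b : ℝ), 0 ≤ a → 0 ≤ b → a + b = 1 →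
      (γ : ℝ) = a * α + b * β →
      U (τ + T x ŷ γ) ≤ a * U (τ + T x ŷ α) + b * U (τ + T x ŷ β)) ∧
    (1 / 2 : ℝ) * U (τ + T x ŷ (slopeTop L)) + (1 / 2 : ℝ) * U (τ + T x ŷ (slopeBot L)) ≤ U τ

/-- `U` is a Burkholder function for the pair `(T, V)`. -/
structure IsBurkholder (T : X → Y → Slope L → 𝒯) (V U : 𝒯 → ℝ) : Prop where
  zero_le : U 0 ≤ 0
  majorizes : ∀ τ, V τ ≤ U τ
  concave : RestrictedConcavity T U ∨ RademacherConcavity T U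

/-- The expectation of a measurable function that is bounded below: a real number, or `+∞`. -/
def expect (q : ProbabilityMeasure Y) (f : Y → ℝ) : EReal :=
  open Classical in
  if Integrable f (q : Measure Y) then ((∫ ŷ, f ŷ ∂(q : Measure Y) : ℝ) : EReal) else ⊤

/-- The objective `sup_y E_{ŷ ∼ q} U (ζ + T (x, ŷ, ∂ℓ (ŷ, y)))` of the Burkholder algorithm. -/
def objective (d : Y → Y → Slope L) (T : X → Y → Slope L → 𝒯) (U : 𝒯 → ℝ)
    (ζ : 𝒯) (x : X) (q : ProbabilityMeasure Y) : EReal :=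
  ⨆ y : Y, expect q (fun ŷ => U (ζ + T x ŷ (d ŷ y)))

/-- `q` is a minimizer of the objective over all Borel probability measures on `Y`. -/
def IsBurkholderStep (d : Y → Y → Slope L) (T : X → Y → Slope L → 𝒯) (U : 𝒯 → ℝ)
    (ζ : 𝒯) (x : X) (q : ProbabilityMeasure Y) : Prop :=
  ∀ q' : ProbabilityMeasure Y, objective d T U ζ x q ≤ objective d T U ζ x q'

/-- A Burkholder algorithm: a rule that sees only the stored statistic `ζ` and the current side
information `x`, and returns a minimizer of the objective. -/
def IsBurkholderAlgorithm (d : Y → Y → Slope L) (T : X → Y → Slope L → 𝒯) (U : 𝒯 → ℝ)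
    (A : 𝒯 → X → ProbabilityMeasure Y) : Prop :=
  ∀ (ζ : 𝒯) (x : X), IsBurkholderStep d T U ζ x (A ζ x)

/-- The upper expectation of an arbitrary function: the infimum of the expectations of its
integrable majorants. It is the usual expectation on integrable functions. -/
def upperExpect (q : ProbabilityMeasure Y) (f : Y → EReal) : EReal :=
  ⨅ (g : Y → ℝ) (_ : Integrable g (q : Measure Y)) (_ : ∀ ŷ, f ŷ ≤ (g ŷ : EReal)),
    ((∫ ŷ, g ŷ ∂(q : Measure Y) : ℝ) : EReal)

/-- The iterated (upper) expectation `E_{ŷ₁} E_{ŷ₂} ⋯` of the total loss of the rule `A` on the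
given list of rounds `(x, y)`, when the memory holds `ζ` at the start: a prediction `ŷ` is drawn
from `A ζ x`, the loss `ℓ (ŷ, y)` is paid, and the memory becomes `ζ + T (x, ŷ, ∂ℓ (ŷ, y))`. -/
def iteratedLoss (ℓ : ℝ → ℝ → ℝ) (d : Y → Y → Slope L) (T : X → Y → Slope L → 𝒯)
    (A : 𝒯 → X → ProbabilityMeasure Y) : List (X × Y) → 𝒯 → EReal
  | [], _ => 0
  | (x, y) :: s, ζ => upperExpect (A ζ x) fun ŷ =>
      ((ℓ ŷ y : ℝ) : EReal) + iteratedLoss ℓ d T A s (ζ + T x ŷ (d ŷ y))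

/-- The memory before round `t`, as a function of the predictions `h` made in the rounds `s < t`. -/
def memory {n : ℕ} (d : Y → Y → Slope L) (T : X → Y → Slope L → 𝒯)
    (x : Fin n → X) (y : Fin n → Y) (t : Fin n) (h : {s : Fin n // s < t} → Y) : 𝒯 :=
  ∑ s : {s : Fin n // s < t}, T (x s) (h s) (d (h s) (y s))

/-- The random predictions `ŷ` form a run of the rule `A` on the sequence `(x, y)`: for each round
`t`, the conditional law of `ŷ t` given the earlier predictions is `A (ζ_{t-1}, x_t)`. -/
def IsRun {n : ℕ} (d : Y → Y → Slope L) (T : X → Y → Slope L → 𝒯)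
    (A : 𝒯 → X → ProbabilityMeasure Y) (x : Fin n → X) (y : Fin n → Y)
    {Ω : Type*} [MeasurableSpace Ω] (P : Measure Ω) [IsFiniteMeasure P]
    (ŷ : Fin n → Ω → Y) : Prop :=
  (∀ t, Measurable (ŷ t)) ∧
  ∀ t : Fin n,
    ∀ᵐ h ∂(P.map fun ω (s : {s : Fin n // s < t}) => ŷ s ω),
      condDistrib (ŷ t) (fun ω (s : {s : Fin n // s < t}) => ŷ s ω) P h
        = (A (memory d T x y t h) (x t) : Measure Y)

end Statistic

end

end OnlineLearning

/-! The potential `U` behaves like a supermartingale along the memory. If the outcome is drawn from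
a known finite mixture, predict a minimizer of the mixed loss: first-order optimality, or the
assumed alternative, gives the slopes `d ŷ y` mean zero there, so concavity keeps the average of `U
(ζ + T x ŷ (d ŷ y))` at most `U ζ` (`sum_mul_le_of_concave`). A minimax argument reverses the order
of play. For finitely many outcomes, separation of convex sets gives one law of `ŷ` that works up to
`ε`; weak compactness of the laws on `Y` and lower semicontinuity then give one that works for all
outcomes without `ε` (`exists_objective_le`). A minimizer of the objective does no worse, so each
round keeps the expected potential at most its current value. Going backwards from `U ≥ V`, and
using `U 0 ≤ 0`, bounds the expected loss by `φ`. This is done for iterated upper expectations in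
`iteratedLoss_le` and for random runs in `IsRun.exists_le_potential`. -/

namespace OnlineLearning

open Filter Topology

/-! ### Finitely supported distributions -/

section Discrete

variable {Ω ι : Type*} [MeasurableSpace Ω] [Fintype ι]

/-- The distribution that puts the weight `w i` on the point `z i`. -/
noncomputable def discreteMeasure (w : ι → ℝ) (z : ι → Ω) : Measure Ω :=
  ∑ i, ENNReal.ofReal (w i) • Measure.dirac (z i)

theorem isProbabilityMeasure_discreteMeasure {w : ι → ℝ} (hw : w ∈ stdSimplex ℝ ι) (z : ι → Ω) :
    IsProbabilityMeasure (discreteMeasure w z) := by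
  constructor
  simp only [discreteMeasure, Measure.coe_finsetSum, Finset.sum_apply, Measure.smul_apply,
    measure_univ, smul_eq_mul, mul_one]
  rw [← ENNReal.ofReal_sum_of_nonneg fun i _ => hw.1 i, hw.2, ENNReal.ofReal_one]

variable [MeasurableSingletonClass Ω]

theorem integrable_discreteMeasure (w : ι → ℝ) (z : ι → Ω) (f : Ω → ℝ) :
    Integrable f (discreteMeasure w z) := by
  refine integrable_finsetSum_measure.2 fun i _ => ?_
  exact (integrable_dirac (by simp)).smul_measure ENNReal.ofReal_ne_top

theorem integral_discreteMeasure {w : ι → ℝ} (hw : ∀ i, 0 ≤ w i) (z : ι → Ω) (f : Ω → ℝ) :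
    ∫ x, f x ∂discreteMeasure w z = ∑ i, w i * f (z i) := by
  rw [discreteMeasure, integral_finsetSum_measure fun i _ =>
    (integrable_dirac (by simp)).smul_measure ENNReal.ofReal_ne_top]
  refine Finset.sum_congr rfl fun i _ => ?_
  rw [integral_smul_measure, integral_dirac, ENNReal.toReal_ofReal (hw i), smul_eq_mul]

theorem of_ae_discreteMeasure {w : ι → ℝ} {z : ι → Ω} {P : Ω → Prop}
    (h : ∀ᵐ x ∂discreteMeasure w z, P x) {i : ι} (hi : 0 < w i) : P (z i) := by
  have h1 : ∀ᵐ x ∂(ENNReal.ofReal (w i) • Measure.dirac (z i)), P x :=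
    (Measure.absolutelyContinuous_of_le
      (Finset.single_le_sum (f := fun i => ENNReal.ofReal (w i) • Measure.dirac (z i))
        (fun _ _ => Measure.zero_le _) (Finset.mem_univ i))).ae_le h
  rw [Measure.ae_ennreal_smul_measure_eq (ENNReal.ofReal_pos.2 hi).ne', ae_dirac_eq] at h1
  exact h1

end Discrete

/-! ### Minimax by separation -/

/-- A finite-dimensional minimax theorem: if each mixture of the coordinates of `f` is at most `c`
somewhere, then a point of the convex hull of the range has all its coordinates below `c + ε`. -/
theorem exists_mem_convexHull_range_lt {α ι : Type*} [Nonempty α] [Fintype ι] (f : α → ι → ℝ)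
    (c : ℝ) (h : ∀ p ∈ stdSimplex ℝ ι, ∃ a, ∑ i, p i * f a i ≤ c) {ε : ℝ} (hε : 0 < ε) :
    ∃ v ∈ convexHull ℝ (Set.range f), ∀ i, v i < c + ε := by
  classical
  by_contra! hne
  set t : Set (ι → ℝ) := Set.pi Set.univ fun _ => Set.Iio (c + ε)
  have hconv : Convex ℝ t := convex_pi fun _ _ => convex_Iio _
  have hopen : IsOpen t := isOpen_set_pi Set.finite_univ fun _ _ => isOpen_Iio
  have hdisj : Disjoint t (convexHull ℝ (Set.range f)) := by
    refine Set.disjoint_left.2 fun v hv hv' => ?_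
    obtain ⟨i, hi⟩ := hne v hv'
    exact absurd (hv i (Set.mem_univ i)) (not_lt.2 hi)
  obtain ⟨g, u, hgt, hgs⟩ :=
    geometric_hahn_banach_open hconv hopen (convex_convexHull ℝ (Set.range f)) hdisj
  set w : ι → ℝ := fun i => g (Pi.single i 1) with hw
  have hg : ∀ v : ι → ℝ, g v = ∑ i, w i * v i := by
    intro v
    conv_lhs => rw [pi_eq_sum_univ' v]
    simp [map_sum, hw, mul_comm]
  have hct : (fun _ => c : ι → ℝ) ∈ t := fun i _ => by simpa using hε
  have hw0 : ∀ i, 0 ≤ w i := by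
    intro i
    by_contra! hi
    have hmem : ∀ M : ℝ, 0 ≤ M → (fun _ => c : ι → ℝ) - M • Pi.single i 1 ∈ t := by
      intro M hM j _
      have : (0 : ℝ) ≤ (Pi.single i 1 : ι → ℝ) j := by
        by_cases hj : j = i
        · subst hj; simp
        · simp [hj]
      simp only [Pi.sub_apply, Pi.smul_apply, smul_eq_mul, Set.mem_Iio]
      nlinarith [mul_nonneg hM this]
    -- With this `M` the shifted point, still in `t`, has `g`-value exactly `u`, against the strict
    -- separation.
    have hM := hgt _ (hmem ((u - g fun _ => c) / -w i)
      (div_nonneg (sub_nonneg.2 (hgt _ hct).le) (neg_nonneg.2 hi.le)))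
    rw [map_sub, map_smul, smul_eq_mul] at hM
    have : (u - g fun _ => c) / -w i * g (Pi.single i 1) = -(u - g fun _ => c) := by
      change _ * w i = _
      rw [div_neg, neg_mul, div_mul_cancel₀ _ hi.ne]
    rw [this] at hM
    linarith
  obtain ⟨a₀⟩ := ‹Nonempty α›
  have hfs : ∀ a, u ≤ g (f a) := fun a => hgs _ (subset_convexHull ℝ _ ⟨a, rfl⟩)
  have hgc : g (fun _ => c) = (∑ i, w i) * c := by rw [hg, Finset.sum_mul]
  -- If all weights vanished, `g` would be zero, forcing both `0 < u` and `u ≤ 0`. So `w` can be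
  -- normalised to a mixture.
  have hS : 0 < ∑ i, w i := by
    refine (Finset.sum_nonneg fun i _ => hw0 i).lt_of_ne fun h0 => ?_
    have hz : ∀ i, w i = 0 := fun i =>
      (Finset.sum_eq_zero_iff_of_nonneg fun i _ => hw0 i).1 h0.symm i (Finset.mem_univ i)
    have h1 := hgt _ hct
    have h2 := hfs a₀
    rw [hg] at h1 h2
    simp only [hz, zero_mul, Finset.sum_const_zero] at h1 h2
    linarith
  obtain ⟨a, ha⟩ := h (fun i => w i / ∑ j, w j)
    ⟨fun i => div_nonneg (hw0 i) hS.le, by rw [← Finset.sum_div, div_self hS.ne']⟩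
  have hga : g (f a) ≤ (∑ i, w i) * c := by
    have : ∑ i, w i / (∑ j, w j) * f a i = g (f a) / ∑ j, w j := by
      rw [hg, Finset.sum_div]
      exact Finset.sum_congr rfl fun i _ => by ring
    rw [this, div_le_iff₀ hS] at ha
    linarith
  linarith [hgt _ hct, hfs a]

/-- One direction of the portmanteau theorem for nonnegative lower semicontinuous functions. -/
theorem lintegral_le_liminf_of_lowerSemicontinuous {Ω : Type*} [MeasurableSpace Ω]
    [TopologicalSpace Ω] [OpensMeasurableSpace Ω] [HasOuterApproxClosed Ω]
    {q : ProbabilityMeasure Ω} {qs : ℕ → ProbabilityMeasure Ω} (hq : Tendsto qs atTop (𝓝 q))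
    {f : Ω → ℝ} (hf : LowerSemicontinuous f) (hf0 : 0 ≤ f) :
    ∫⁻ x, ENNReal.ofReal (f x) ∂(q : Measure Ω)
      ≤ atTop.liminf fun i => ∫⁻ x, ENNReal.ofReal (f x) ∂(qs i : Measure Ω) := by
  -- Layer cake: the superlevel sets are open, so portmanteau applies to each, and Fatou integrates
  -- over the levels.
  simp_rw [lintegral_eq_lintegral_meas_lt _ (Eventually.of_forall hf0) hf.measurable.aemeasurable]
  calc ∫⁻ t in Set.Ioi (0 : ℝ), (q : Measure Ω) {a | t < f a}
      ≤ ∫⁻ t in Set.Ioi (0 : ℝ), atTop.liminf fun i => (qs i : Measure Ω) {a | t < f a} :=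
        lintegral_mono fun t =>
          ProbabilityMeasure.le_liminf_measure_open_of_tendsto hq (hf.isOpen_preimage t)
    _ ≤ atTop.liminf fun i => ∫⁻ t in Set.Ioi (0 : ℝ), (qs i : Measure Ω) {a | t < f a} :=
        lintegral_liminf_le fun n => Antitone.measurable fun s t hst =>
          measure_mono fun ω hω => lt_of_le_of_lt hst hω

/-! ### Semicontinuity of the expectation in the distribution -/

section Expect

variable {Y : NonemptyCompacts ℝ}

instance : CompactSpace Y := isCompact_iff_compactSpace.1 Y.isCompact

instance : Nonempty Y := Y.nonempty.to_subtype

instance : Nonempty (ProbabilityMeasure Y) :=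
  let ⟨y⟩ := (inferInstance : Nonempty Y)
  ⟨⟨Measure.dirac y, inferInstance⟩⟩

theorem expect_le_coe {q : ProbabilityMeasure Y} {f : Y → ℝ} {c : ℝ} :
    expect q f ≤ (c : EReal) ↔
      Integrable f (q : Measure Y) ∧ ∫ ŷ, f ŷ ∂(q : Measure Y) ≤ c := by
  unfold expect
  split_ifs with h
  · simp [h]
  · simp [h]

theorem bddBelow_of_lowerSemicontinuous {f : Y → ℝ} (hf : LowerSemicontinuous f) :
    ∃ m, ∀ ŷ, m ≤ f ŷ := by
  obtain ⟨m, hm⟩ := (hf.lowerSemicontinuousOn Set.univ).bddBelow_of_isCompact isCompact_univ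
  exact ⟨m, fun ŷ => hm ⟨ŷ, trivial, rfl⟩⟩

/-- After a shift to nonnegative values, non-integrability is the same as an infinite `lintegral`,
so the value `⊤` is covered too. -/
theorem expect_le_coe_iff_lintegral {q : ProbabilityMeasure Y} {f : Y → ℝ} {c C : ℝ}
    (hf : Measurable f) (hC : ∀ ŷ, 0 ≤ f ŷ + C) (hc : 0 ≤ c + C) :
    expect q f ≤ (c : EReal) ↔
      ∫⁻ ŷ, ENNReal.ofReal (f ŷ + C) ∂(q : Measure Y) ≤ ENNReal.ofReal (c + C) := by
  have hm : AEStronglyMeasurable (fun ŷ => f ŷ + C) (q : Measure Y) :=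
    (hf.add_const C).aestronglyMeasurable
  have hnn : 0 ≤ᵐ[(q : Measure Y)] fun ŷ => f ŷ + C := Eventually.of_forall hC
  have hint : ∀ h : Integrable f (q : Measure Y),
      ∫ ŷ, (f ŷ + C) ∂(q : Measure Y) = ∫ ŷ, f ŷ ∂(q : Measure Y) + C := by
    intro h
    rw [integral_add h (integrable_const C)]
    simp
  rw [expect_le_coe]
  constructor
  · rintro ⟨h1, h2⟩
    have h3 : Integrable (fun ŷ => f ŷ + C) (q : Measure Y) := h1.add (integrable_const C)
    rw [← ofReal_integral_eq_lintegral_ofReal h3 hnn]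
    refine ENNReal.ofReal_le_ofReal ?_
    linarith [hint h1]
  · intro h
    have h1 : Integrable (fun ŷ => f ŷ + C) (q : Measure Y) :=
      (lintegral_ofReal_ne_top_iff_integrable hm hnn).1 (h.trans_lt ENNReal.ofReal_lt_top).ne
    have h2 : Integrable f (q : Measure Y) := by
      refine (h1.sub (integrable_const C)).congr (Eventually.of_forall fun ŷ => ?_)
      simp
    refine ⟨h2, ?_⟩
    rw [← ofReal_integral_eq_lintegral_ofReal h1 hnn, ENNReal.ofReal_le_ofReal_iff hc] at h
    linarith [hint h2]

theorem isClosed_setOf_expect_le {f : Y → ℝ} (hf : LowerSemicontinuous f) (c : ℝ) :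
    IsClosed {q : ProbabilityMeasure Y | expect q f ≤ (c : EReal)} := by
  obtain ⟨m, hm⟩ := bddBelow_of_lowerSemicontinuous hf
  -- The shift must make both `f` and the level `c` nonnegative, since `ENNReal.ofReal` truncates.
  set C : ℝ := max (-m) (-c)
  have hC : ∀ ŷ, 0 ≤ f ŷ + C := fun ŷ => by linarith [hm ŷ, le_max_left (-m) (-c)]
  have hc : 0 ≤ c + C := by linarith [le_max_right (-m) (-c)]
  have hlsc : LowerSemicontinuous fun ŷ => f ŷ + C := hf.add lowerSemicontinuous_const
  simp_rw [expect_le_coe_iff_lintegral hf.measurable hC hc]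
  refine IsSeqClosed.isClosed fun qs q hqs hq => ?_
  exact (lintegral_le_liminf_of_lowerSemicontinuous hq hlsc hC).trans
    (liminf_le_of_le (by isBoundedDefault) fun b hb =>
      let ⟨i, hi⟩ := hb.exists
      hi.trans (hqs i))

theorem lowerSemicontinuous_expect {f : Y → ℝ} (hf : LowerSemicontinuous f) :
    LowerSemicontinuous fun q : ProbabilityMeasure Y => expect q f := by
  refine lowerSemicontinuous_iff_isClosed_preimage.2 fun c => ?_
  induction c with
  | bot =>
    convert isClosed_empty
    ext q
    simp only [Set.mem_preimage, Set.mem_Iic, le_bot_iff, Set.mem_empty_iff_false, iff_false]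
    unfold expect
    split_ifs <;> simp
  | coe c => exact isClosed_setOf_expect_le hf c
  | top => simp

end Expect

/-! ### The value of one round -/

section Value

variable {X : Type*} {𝒯 : Type*} [AddCommGroup 𝒯]
  {Y : NonemptyCompacts ℝ} {L : NNReal} {ℓ : ℝ → ℝ → ℝ} {d : Y → Y → Slope L}
  {T : X → Y → Slope L → 𝒯} {U : 𝒯 → ℝ}

theorem exists_isBurkholderStep
    (hlsc : ∀ (τ : 𝒯) (x : X) (y : Y), LowerSemicontinuous fun ŷ : Y => U (τ + T x ŷ (d ŷ y)))
    (ζ : 𝒯) (x : X) : ∃ q : ProbabilityMeasure Y, IsBurkholderStep d T U ζ x q := by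
  have h : LowerSemicontinuous (objective d T U ζ x) :=
    lowerSemicontinuous_iSup fun y => lowerSemicontinuous_expect (hlsc ζ x y)
  obtain ⟨q, -, hq⟩ :=
    (h.lowerSemicontinuousOn Set.univ).exists_isMinOn Set.univ_nonempty isCompact_univ
  exact ⟨q, fun q' => hq (Set.mem_univ q')⟩

/-- Subtracting the supporting line leaves a function minimal at `ŷ`, whose derivative there
vanishes. -/
theorem AdmissibleLoss.hasDerivAt (hℓ : AdmissibleLoss Y L ℓ d) {ŷ y : Y}
    (h : DifferentiableAt ℝ (fun z => ℓ z y) (ŷ : ℝ)) :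
    HasDerivAt (fun z => ℓ z y) (d ŷ y : ℝ) (ŷ : ℝ) := by
  have h1 : HasDerivAt (fun z => ℓ z y - (d ŷ y : ℝ) * z)
      (deriv (fun z => ℓ z y) (ŷ : ℝ) - (d ŷ y : ℝ) * 1) (ŷ : ℝ) :=
    h.hasDerivAt.sub ((hasDerivAt_id (ŷ : ℝ)).const_mul _)
  have hmin : IsLocalMin (fun z => ℓ z y - (d ŷ y : ℝ) * z) (ŷ : ℝ) :=
    Eventually.of_forall fun z => by
      change ℓ ŷ y - _ ≤ ℓ z y - _
      linarith [hℓ.subderivative ŷ y z, mul_sub (d ŷ y : ℝ) z ŷ]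
  have h2 := hmin.hasDerivAt_eq_zero h1
  have h3 : deriv (fun z => ℓ z y) (ŷ : ℝ) = (d ŷ y : ℝ) := by linarith
  exact h3 ▸ h.hasDerivAt

/-- Every finite mixture of the losses has a minimizer at which the mixture of the selected
subderivatives vanishes. -/
theorem AdmissibleLoss.exists_sum_mul_eq_zero (hℓ : AdmissibleLoss Y L ℓ d) {ι : Type*}
    [Fintype ι] {p : ι → ℝ} (hp : p ∈ stdSimplex ℝ ι) (y : ι → Y) :
    ∃ ŷ : Y, ∑ i, p i * (d ŷ (y i) : ℝ) = 0 := by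
  obtain ⟨ŷ, hmin, hd | ⟨-, hd⟩⟩ :=
    hℓ.minimizer ⟨discreteMeasure p y, isProbabilityMeasure_discreteMeasure hp y⟩
      fun z => integrable_discreteMeasure p y _
  · refine ⟨ŷ, ?_⟩
    simp only [ProbabilityMeasure.coe_mk, integral_discreteMeasure hp.1] at hmin hd
    have hder : HasDerivAt (fun z => ∑ i, p i * ℓ z (y i)) (∑ i, p i * (d ŷ (y i) : ℝ)) (ŷ : ℝ) := by
      refine HasDerivAt.fun_sum fun i _ => ?_
      rcases (hp.1 i).eq_or_lt with h0 | h0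
      · simpa [← h0] using hasDerivAt_const (ŷ : ℝ) (0 : ℝ)
      · exact (hℓ.hasDerivAt (of_ae_discreteMeasure hd h0)).const_mul _
    exact IsLocalMin.hasDerivAt_eq_zero (Eventually.of_forall hmin) hder
  · refine ⟨ŷ, ?_⟩
    simpa only [ProbabilityMeasure.coe_mk, integral_discreteMeasure hp.1] using hd

/-- Both forms of concavity give the inequality for finitely supported mean-zero distributions. -/
theorem sum_mul_le_of_concave (hU : RestrictedConcavity T U ∨ RademacherConcavity T U)
    {ι : Type*} [Fintype ι] {p : ι → ℝ} (hp : p ∈ stdSimplex ℝ ι) (α : ι → Slope L)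
    (hα : ∑ i, p i * (α i : ℝ) = 0) (τ : 𝒯) (x : X) (ŷ : Y) :
    ∑ i, p i * U (τ + T x ŷ (α i)) ≤ U τ := by
  rcases hU with hU | hU
  · have h := hU τ x ŷ ⟨discreteMeasure p α, isProbabilityMeasure_discreteMeasure hp α⟩
    simp only [ProbabilityMeasure.coe_mk, integral_discreteMeasure hp.1] at h
    exact h hα (integrable_discreteMeasure p α _)
  · obtain ⟨hconv, hrad⟩ := hU τ x ŷ
    -- For `L = 0` the interval is a point and the chord coefficients would divide by zero.
    rcases (NNReal.coe_nonneg L).eq_or_lt with hL | hL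
    · have hα' : ∀ i, α i = slopeTop L := fun i => Subtype.ext <| by
        have h1 := (α i).2.1
        have h2 := (α i).2.2
        change (α i : ℝ) = L
        linarith
      have hbt : slopeBot L = slopeTop L := Subtype.ext (by simp [slopeTop, slopeBot, ← hL])
      simp only [hα', ← Finset.sum_mul, hp.2]
      rw [hbt] at hrad
      linarith
    · set a := U (τ + T x ŷ (slopeTop L))
      set b := U (τ + T x ŷ (slopeBot L))
      -- Convexity puts the function below its chord over `[-L, L]`. The chord is affine in `α`, so
      -- its mean depends only on the mean of `α`, which is zero.
      have hle : ∀ i, U (τ + T x ŷ (α i))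
          ≤ (1 / 2 + (α i : ℝ) / (2 * L)) * a + (1 / 2 - (α i : ℝ) / (2 * L)) * b := by
        intro i
        have h1 : -(1 / 2) ≤ (α i : ℝ) / (2 * L) := by
          rw [le_div_iff₀ (by positivity)]
          linarith [(α i).2.1]
        have h2 : (α i : ℝ) / (2 * L) ≤ 1 / 2 := by
          rw [div_le_iff₀ (by positivity)]
          linarith [(α i).2.2]
        refine hconv (slopeTop L) (slopeBot L) (α i) _ _ (by linarith) (by linarith) (by ring) ?_
        simp only [slopeTop, slopeBot]
        field_simp
        ring
      calc ∑ i, p i * U (τ + T x ŷ (α i))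
          ≤ ∑ i, p i * ((1 / 2 + (α i : ℝ) / (2 * L)) * a + (1 / 2 - (α i : ℝ) / (2 * L)) * b) :=
            Finset.sum_le_sum fun i _ => mul_le_mul_of_nonneg_left (hle i) (hp.1 i)
        _ = ∑ i, (p i * (1 / 2 * a + 1 / 2 * b) + p i * (α i : ℝ) * ((a - b) / (2 * L))) :=
            Finset.sum_congr rfl fun i _ => by ring
        _ = 1 / 2 * a + 1 / 2 * b := by
            rw [Finset.sum_add_distrib, ← Finset.sum_mul, ← Finset.sum_mul, hp.2, hα]
            ring
        _ ≤ U τ := hrad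

/-- Against finitely many outcomes, some finitely supported distribution keeps the expected
potential below `U ζ + ε`. -/
theorem exists_forall_mem_expect_le (hℓ : AdmissibleLoss Y L ℓ d)
    (hU : RestrictedConcavity T U ∨ RademacherConcavity T U) (ζ : 𝒯) (x : X) (s : Finset Y)
    {ε : ℝ} (hε : 0 < ε) :
    ∃ q : ProbabilityMeasure Y, ∀ y ∈ s,
      expect q (fun ŷ => U (ζ + T x ŷ (d ŷ y))) ≤ ((U ζ + ε : ℝ) : EReal) := by
  obtain ⟨v, hv, hlt⟩ := exists_mem_convexHull_range_lt
    (fun (ŷ : Y) (y : s) => U (ζ + T x ŷ (d ŷ y))) (U ζ) (fun p hp => by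
      obtain ⟨ŷ, hŷ⟩ := hℓ.exists_sum_mul_eq_zero hp fun y : s => (y : Y)
      exact ⟨ŷ, sum_mul_le_of_concave hU hp _ hŷ ζ x ŷ⟩) hε
  obtain ⟨ι, _, w, z, hw, hw1, hz, rfl⟩ := mem_convexHull_iff_exists_fintype.1 hv
  choose ŷ hŷ using hz
  refine ⟨⟨discreteMeasure w ŷ, isProbabilityMeasure_discreteMeasure ⟨hw, hw1⟩ ŷ⟩,
    fun y hy => expect_le_coe.2 ⟨integrable_discreteMeasure _ _ _, ?_⟩⟩
  rw [ProbabilityMeasure.coe_mk, integral_discreteMeasure hw]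
  refine le_trans (le_of_eq ?_) (hlt ⟨y, hy⟩).le
  simp [Finset.sum_apply, ← hŷ]

/-- The minimax value of one round is at most the current potential. -/
theorem exists_objective_le (hℓ : AdmissibleLoss Y L ℓ d)
    (hU : RestrictedConcavity T U ∨ RademacherConcavity T U)
    (hlsc : ∀ (τ : 𝒯) (x : X) (y : Y), LowerSemicontinuous fun ŷ : Y => U (τ + T x ŷ (d ŷ y)))
    (ζ : 𝒯) (x : X) :
    ∃ q : ProbabilityMeasure Y, objective d T U ζ x q ≤ (U ζ : EReal) := by
  classical
  -- The slack is part of the index: a finite subfamily has a least slack, which the finite case can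
  -- meet, and the full intersection lets it tend to zero.
  let K : Y × Set.Ioi (0 : ℝ) → Set (ProbabilityMeasure Y) := fun i =>
    {q | expect q (fun ŷ => U (ζ + T x ŷ (d ŷ i.1))) ≤ ((U ζ + i.2 : ℝ) : EReal)}
  obtain ⟨q, hq⟩ : (⋂ i, K i).Nonempty := by
    refine CompactSpace.iInter_nonempty
      (fun i => isClosed_setOf_expect_le (hlsc ζ x i.1) _) fun s => ?_
    obtain ⟨ε, hε, hεs⟩ : ∃ ε : ℝ, 0 < ε ∧ ∀ i ∈ s, ε ≤ (i.2 : ℝ) := by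
      induction s using Finset.induction_on with
      | empty => exact ⟨1, one_pos, by simp⟩
      | insert i s _ ih =>
        obtain ⟨ε, hε, h⟩ := ih
        refine ⟨min ε i.2, lt_min hε i.2.2, fun j hj => ?_⟩
        rcases Finset.mem_insert.1 hj with rfl | hj
        · exact min_le_right _ _
        · exact (min_le_left _ _).trans (h j hj)
    obtain ⟨q, hq⟩ := exists_forall_mem_expect_le hℓ hU ζ x (s.image Prod.fst) hε
    refine ⟨q, Set.mem_iInter₂.2 fun i hi => ?_⟩
    refine (hq i.1 (Finset.mem_image_of_mem _ hi)).trans ?_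
    exact EReal.coe_le_coe_iff.2 (by linarith [hεs i hi])
  refine ⟨q, iSup_le fun y => ?_⟩
  have hy : ∀ ε : ℝ, 0 < ε → expect q (fun ŷ => U (ζ + T x ŷ (d ŷ y))) ≤ ((U ζ + ε : ℝ) : EReal) :=
    fun ε hε => Set.mem_iInter.1 hq (y, ⟨ε, hε⟩)
  simp only [expect_le_coe] at hy ⊢
  exact ⟨(hy 1 one_pos).1, le_of_forall_pos_le_add fun ε hε => (hy ε hε).2⟩

theorem IsBurkholderAlgorithm.integrable_and_integral_le {A : 𝒯 → X → ProbabilityMeasure Y}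
    (hA : IsBurkholderAlgorithm d T U A) (hℓ : AdmissibleLoss Y L ℓ d)
    (hU : RestrictedConcavity T U ∨ RademacherConcavity T U)
    (hlsc : ∀ (τ : 𝒯) (x : X) (y : Y), LowerSemicontinuous fun ŷ : Y => U (τ + T x ŷ (d ŷ y)))
    (ζ : 𝒯) (x : X) (y : Y) :
    Integrable (fun ŷ => U (ζ + T x ŷ (d ŷ y))) (A ζ x : Measure Y) ∧
      ∫ ŷ, U (ζ + T x ŷ (d ŷ y)) ∂(A ζ x : Measure Y) ≤ U ζ := by
  obtain ⟨q, hq⟩ := exists_objective_le hℓ hU hlsc ζ x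
  exact expect_le_coe.1 ((le_iSup (fun y => expect (A ζ x) fun ŷ => U (ζ + T x ŷ (d ŷ y))) y).trans
    ((hA ζ x q).trans hq))

end Value

/-! ### Backward induction over the rounds -/

section Regret

variable {X : Type*} {𝒯 : Type*} [AddCommGroup 𝒯]
  {Y : NonemptyCompacts ℝ} {L : NNReal} {ℓ : ℝ → ℝ → ℝ} {d : Y → Y → Slope L}
  {T : X → Y → Slope L → 𝒯} {U : 𝒯 → ℝ} {A : 𝒯 → X → ProbabilityMeasure Y}

/-- If the total loss on every path is at most `K` plus the final potential, then the iterated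
upper expectation of the total loss is at most `K` plus the initial potential. -/
theorem iteratedLoss_le
    (hA : ∀ (ζ : 𝒯) (x : X) (y : Y),
      Integrable (fun ŷ => U (ζ + T x ŷ (d ŷ y))) (A ζ x : Measure Y) ∧
        ∫ ŷ, U (ζ + T x ŷ (d ŷ y)) ∂(A ζ x : Measure Y) ≤ U ζ)
    {n : ℕ} (z : Fin n → X × Y) (ζ : 𝒯) (K : ℝ)
    (h : ∀ ŷ : Fin n → Y, ∑ t, ℓ (ŷ t) (z t).2
      ≤ K + U (ζ + ∑ t, T (z t).1 (ŷ t) (d (ŷ t) (z t).2))) :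
    iteratedLoss ℓ d T A (List.ofFn z) ζ ≤ ((K + U ζ : ℝ) : EReal) := by
  induction n generalizing ζ K with
  | zero =>
    simp only [List.ofFn_zero, iteratedLoss]
    simpa using EReal.coe_le_coe_iff.2 (h Fin.elim0)
  | succ n ih =>
    obtain ⟨hint, hle⟩ := hA ζ (z 0).1 (z 0).2
    rw [List.ofFn_succ]
    have hstep : ∀ ŷ : Y, ((ℓ ŷ (z 0).2 : ℝ) : EReal) +
        iteratedLoss ℓ d T A (List.ofFn fun i => z i.succ) (ζ + T (z 0).1 ŷ (d ŷ (z 0).2))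
          ≤ ((K + U (ζ + T (z 0).1 ŷ (d ŷ (z 0).2)) : ℝ) : EReal) := by
      intro ŷ
      -- The loss just paid is charged to the constant `K`.
      have := ih (fun i => z i.succ) (ζ + T (z 0).1 ŷ (d ŷ (z 0).2)) (K - ℓ ŷ (z 0).2) fun ŷs => by
        have := h (Fin.cons ŷ ŷs)
        simp only [Fin.sum_univ_succ, Fin.cons_zero, Fin.cons_succ, ← add_assoc] at this
        linarith
      refine (add_le_add_right this _).trans (le_of_eq ?_)
      rw [← EReal.coe_add]
      congr 1
      ring
    have hint' : Integrable (fun ŷ => K + U (ζ + T (z 0).1 ŷ (d ŷ (z 0).2)))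
        (A ζ (z 0).1 : Measure Y) := (integrable_const K).add hint
    change upperExpect (A ζ (z 0).1) (fun ŷ => ((ℓ ŷ (z 0).2 : ℝ) : EReal) +
      iteratedLoss ℓ d T A (List.ofFn fun i => z i.succ) (ζ + T (z 0).1 ŷ (d ŷ (z 0).2))) ≤ _
    unfold upperExpect
    -- The shifted potential is an integrable majorant, so measurability of the later losses, hence
    -- of `A`, is never needed.
    refine iInf_le_of_le _ (iInf_le_of_le hint' (iInf_le_of_le hstep
      (EReal.coe_le_coe_iff.2 ?_)))
    rw [integral_add (integrable_const K) hint]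
    simpa using hle

theorem AdmissibleLoss.continuous (hℓ : AdmissibleLoss Y L ℓ d) (y : Y) :
    Continuous fun ŷ : Y => ℓ ŷ y :=
  continuousOn_iff_continuous_domRestrict.1 (hℓ.lipschitz y).continuousOn

/-! ### Runs on a probability space -/

section Run

variable {n : ℕ} {Ω : Type*} [MeasurableSpace Ω] {P : Measure Ω} [IsProbabilityMeasure P]

/-- The first `k` predictions. -/
abbrev history (ŷ : Fin n → Ω → Y) (k : ℕ) : Ω → {s : Fin n // (s : ℕ) < k} → Y :=
  fun ω s => ŷ s ω

/-- Extends a history of `k` predictions by one more prediction. -/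
def appendHistory (k : ℕ) (h : ({s : Fin n // (s : ℕ) < k} → Y) × Y) :
    {s : Fin n // (s : ℕ) < k + 1} → Y :=
  fun s => if hs : (s : ℕ) < k then h.1 ⟨s, hs⟩ else h.2

theorem measurable_appendHistory (k : ℕ) :
    Measurable (appendHistory k : ({s : Fin n // (s : ℕ) < k} → Y) × Y → _) := by
  refine measurable_pi_lambda _ fun s => ?_
  unfold appendHistory
  split_ifs with hs
  · exact (measurable_pi_apply _).comp measurable_fst
  · exact measurable_snd

/-- The memory after `k` rounds with the predictions `h`. -/
noncomputable def memoryAfter (d : Y → Y → Slope L) (T : X → Y → Slope L → 𝒯) (x : Fin n → X)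
    (y : Fin n → Y) (k : ℕ) (h : {s : Fin n // (s : ℕ) < k} → Y) : 𝒯 :=
  ∑ s : {s : Fin n // (s : ℕ) < k}, T (x s) (h s) (d (h s) (y s))

theorem sum_subtype_lt_succ {M : Type*} [AddCommMonoid M] {k : ℕ} (hk : k < n)
    (f : {s : Fin n // (s : ℕ) < k + 1} → M) :
    ∑ s, f s = ∑ s : {s : Fin n // (s : ℕ) < k}, f ⟨s, s.2.trans k.lt_succ_self⟩
      + f ⟨⟨k, hk⟩, k.lt_succ_self⟩ := by
  classical
  let e : Option {s : Fin n // (s : ℕ) < k} ≃ {s : Fin n // (s : ℕ) < k + 1} :=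
    { toFun := fun o => o.elim ⟨⟨k, hk⟩, k.lt_succ_self⟩ fun s => ⟨s, s.2.trans k.lt_succ_self⟩
      invFun := fun s => if hs : (s : ℕ) < k then some ⟨s, hs⟩ else none
      left_inv := by
        rintro (_ | s)
        · simp
        · simp [s.2]
      right_inv := by
        rintro ⟨s, hs⟩
        by_cases h : (s : ℕ) < k
        · simp [h]
        · have : (s : ℕ) = k := by omega
          simp only [h, dite_false, Option.elim]
          exact Subtype.ext (Fin.ext this.symm) }
  rw [← e.sum_comp, Fintype.sum_option, add_comm]
  rfl

theorem memoryAfter_appendHistory (x : Fin n → X) (y : Fin n → Y) {k : ℕ} (hk : k < n)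
    (h : {s : Fin n // (s : ℕ) < k} → Y) (ŷ : Y) :
    memoryAfter d T x y (k + 1) (appendHistory k (h, ŷ))
      = memoryAfter d T x y k h + T (x ⟨k, hk⟩) ŷ (d ŷ (y ⟨k, hk⟩)) := by
  simp only [memoryAfter]
  rw [sum_subtype_lt_succ hk]
  congr 1
  · refine Finset.sum_congr rfl fun s _ => ?_
    simp [appendHistory, s.2]
  · simp [appendHistory]

/-- The conditional expectation of a random variable `S` given the first `k` predictions of a run is
at most `K` plus the potential after `k` rounds, if this is so for `k = n`. -/
theorem IsRun.exists_le_potential {x : Fin n → X} {y : Fin n → Y} {ŷ : Fin n → Ω → Y}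
    (hrun : IsRun d T A x y P ŷ)
    (hA : ∀ (ζ : 𝒯) (x : X) (y : Y),
      Integrable (fun ŷ => U (ζ + T x ŷ (d ŷ y))) (A ζ x : Measure Y) ∧
        ∫ ŷ, U (ζ + T x ŷ (d ŷ y)) ∂(A ζ x : Measure Y) ≤ U ζ)
    {S K : ℝ} {k : ℕ} (hk : k ≤ n)
    (hn : ∃ W : ({s : Fin n // (s : ℕ) < n} → Y) → ℝ,
      Integrable W (P.map (history ŷ n)) ∧ ∫ h, W h ∂(P.map (history ŷ n)) = S ∧
      ∀ᵐ h ∂(P.map (history ŷ n)),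
        W h ≤ K + U (memoryAfter d T x y n h)) :
    ∃ W : ({s : Fin n // (s : ℕ) < k} → Y) → ℝ,
      Integrable W (P.map (history ŷ k)) ∧ ∫ h, W h ∂(P.map (history ŷ k)) = S ∧
      ∀ᵐ h ∂(P.map (history ŷ k)),
        W h ≤ K + U (memoryAfter d T x y k h) := by
  induction hk using Nat.decreasingInduction with
  | self => exact hn
  -- The potential need not be measurable in the history, so an integrable `W` below it is carried
  -- along; `U` is integrated only in the newest prediction, where `hA` applies.
  | of_succ k hk ih =>
    obtain ⟨W, hW, hWS, hWle⟩ := ih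
    obtain ⟨hmeas, hcond⟩ := hrun
    set t : Fin n := ⟨k, hk⟩
    let H := history ŷ k
    have hH : Measurable H := measurable_pi_lambda _ fun s => hmeas s
    have : IsProbabilityMeasure (P.map H) := Measure.isProbabilityMeasure_map hH.aemeasurable
    let κ := condDistrib (ŷ t) H P
    have hκ : ∀ᵐ h ∂(P.map H), κ h = (A (memoryAfter d T x y k h) (x t) : Measure Y) := hcond t
    have hlaw : P.map (history ŷ (k + 1))
        = (P.map H ⊗ₘ κ).map (appendHistory k) := by
      rw [compProd_map_condDistrib (hmeas t).aemeasurable,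
        Measure.map_map (measurable_appendHistory k) (hH.prodMk (hmeas t))]
      congr 1
      ext1 ω
      ext1 ⟨s, hs⟩
      by_cases h : (s : ℕ) < k
      · simp [appendHistory, h, H]
      · have : s = t := Fin.ext (by simp [t]; omega)
        subst this
        simp [appendHistory, h]
    have happ := (measurable_appendHistory (n := n) (Y := Y) k).aemeasurable
      (μ := P.map H ⊗ₘ κ)
    rw [hlaw] at hW hWS hWle
    rw [integral_map happ hW.aestronglyMeasurable] at hWS
    have hW' : Integrable (fun z => W (appendHistory k z)) (P.map H ⊗ₘ κ) := hW.comp_aemeasurable happ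
    have hWle' := Measure.ae_ae_of_ae_compProd (ae_of_ae_map happ hWle)
    rw [Measure.integral_compProd hW'] at hWS
    have hmean : Integrable (fun h => ∫ v, W (appendHistory k (h, v)) ∂κ h) (P.map H) := by
      rw [Measure.compProd] at hW'
      simpa using hW'.integral_compProd
    -- Averaging over the newest prediction preserves the mean `S`.
    refine ⟨fun h => ∫ v, W (appendHistory k (h, v)) ∂κ h, hmean, hWS, ?_⟩
    have hsec := ((Measure.integrable_compProd_iff hW'.aestronglyMeasurable).1 hW').1
    filter_upwards [hκ, hWle', hsec] with h h1 h2 h3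
    obtain ⟨hint, hle⟩ := hA (memoryAfter d T x y k h) (x t) (y t)
    rw [h1] at h2 h3 ⊢
    calc ∫ v, W (appendHistory k (h, v)) ∂(A (memoryAfter d T x y k h) (x t) : Measure Y)
        ≤ ∫ v, (K + U (memoryAfter d T x y k h + T (x t) v (d v (y t))))
            ∂(A (memoryAfter d T x y k h) (x t) : Measure Y) := by
          refine integral_mono_ae h3 ((integrable_const K).add hint) ?_
          filter_upwards [h2] with v hv
          rwa [memoryAfter_appendHistory x y hk] at hv
      _ ≤ K + U (memoryAfter d T x y k h) := by
          rw [integral_add (integrable_const K) hint]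
          simpa using hle

end Run

end Regret

/-! ### The bound for random runs -/

section Bound

variable {X : Type*} {𝒯 : Type*} [AddCommGroup 𝒯]
  {Y : NonemptyCompacts ℝ} {L : NNReal} {ℓ : ℝ → ℝ → ℝ} {d : Y → Y → Slope L}
  {T : X → Y → Slope L → 𝒯} {U : 𝒯 → ℝ} {A : 𝒯 → X → ProbabilityMeasure Y}
  {n : ℕ} {Ω : Type*} [MeasurableSpace Ω] {P : Measure Ω} [IsProbabilityMeasure P]

theorem AdmissibleLoss.integrable_sum (hℓ : AdmissibleLoss Y L ℓ d) (y : Fin n → Y)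
    {h : Fin n → Ω → Y} (hh : ∀ t, Measurable (h t)) :
    Integrable (fun ω => ∑ t, ℓ (h t ω) (y t)) P := by
  refine integrable_finsetSum _ fun t _ => ?_
  obtain ⟨C, hC⟩ := isCompact_univ.exists_bound_of_continuousOn (hℓ.continuous (y t)).continuousOn
  exact Integrable.of_bound ((hℓ.continuous (y t)).measurable.comp (hh t)).aestronglyMeasurable C
    (Filter.Eventually.of_forall fun ω => hC _ trivial)

theorem IsRun.integral_sum_le {x : Fin n → X} {y : Fin n → Y} {ŷ : Fin n → Ω → Y}
    (hrun : IsRun d T A x y P ŷ) (hℓ : AdmissibleLoss Y L ℓ d)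
    (hA : ∀ (ζ : 𝒯) (x : X) (y : Y),
      Integrable (fun ŷ => U (ζ + T x ŷ (d ŷ y))) (A ζ x : Measure Y) ∧
        ∫ ŷ, U (ζ + T x ŷ (d ŷ y)) ∂(A ζ x : Measure Y) ≤ U ζ)
    {K : ℝ} (hK : ∀ h : Fin n → Y,
      ∑ t, ℓ (h t) (y t) ≤ K + U (∑ t, T (x t) (h t) (d (h t) (y t)))) :
    ∫ ω, ∑ t, ℓ (ŷ t ω) (y t) ∂P ≤ K + U 0 := by
  have hH : ∀ k, Measurable (history ŷ k) :=
    fun k => measurable_pi_lambda _ fun s => hrun.1 s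
  have hprob : ∀ k, IsProbabilityMeasure
      (P.map (history ŷ k)) :=
    fun k => Measure.isProbabilityMeasure_map (hH k).aemeasurable
  let W : ({s : Fin n // (s : ℕ) < n} → Y) → ℝ := fun h => ∑ t : Fin n, ℓ (h ⟨t, t.2⟩) (y t)
  have hW : Integrable W (P.map (history ŷ n)) :=
    hℓ.integrable_sum y fun t => measurable_pi_apply _
  obtain ⟨W₀, hW₀, hS, hle⟩ := hrun.exists_le_potential hA (K := K) (Nat.zero_le n)
    ⟨W, hW, integral_map (hH n).aemeasurable hW.aestronglyMeasurable,
      Filter.Eventually.of_forall fun h => by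
        refine (hK fun t => h ⟨t, t.2⟩).trans (le_of_eq ?_)
        congr 2
        exact ((Equiv.subtypeUnivEquiv fun t : Fin n => t.2).symm.sum_comp
          fun s => T (x s) (h s) (d (h s) (y s)))⟩
  calc ∫ ω, ∑ t, ℓ (ŷ t ω) (y t) ∂P = _ := hS.symm
    _ ≤ ∫ _, (K + U 0) ∂(P.map (history ŷ 0)) := by
      refine integral_mono_ae hW₀ (integrable_const _) ?_
      filter_upwards [hle] with h hh
      -- Before the first round the memory is an empty sum, so the potential is `U 0`.
      have : IsEmpty {s : Fin n // (s : ℕ) < 0} := ⟨fun s => Nat.not_lt_zero _ s.2⟩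
      rwa [memoryAfter, Fintype.sum_empty] at hh
    _ = K + U 0 := by simp

end Bound

end OnlineLearning

theorem mainTheorem2 {X 𝒯 : Type*} [AddCommGroup 𝒯] [Module ℝ 𝒯]
    (Y : NonemptyCompacts ℝ) (L : NNReal) (n : ℕ)
    (ℓ : ℝ → ℝ → ℝ) (d : Y → Y → OnlineLearning.Slope L)
    (hℓ : OnlineLearning.AdmissibleLoss Y L ℓ d)
    (φ : (Fin n → X) → (Fin n → Y) → ℝ)
    (T : X → Y → OnlineLearning.Slope L → 𝒯) (V U : 𝒯 → ℝ)
    (hTV : OnlineLearning.IsSufficientPair ℓ d φ T V)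
    (hU : OnlineLearning.IsBurkholder T V U)
    (hlsc : ∀ (τ : 𝒯) (x : X) (y : Y),
      LowerSemicontinuous fun ŷ : Y => U (τ + T x ŷ (d ŷ y))) :
    (∀ (ζ : 𝒯) (x : X), ∃ q : ProbabilityMeasure Y,
      OnlineLearning.IsBurkholderStep d T U ζ x q) ∧
    ∀ A : 𝒯 → X → ProbabilityMeasure Y, OnlineLearning.IsBurkholderAlgorithm d T U A →
      ∀ (x : Fin n → X) (y : Fin n → Y),
        OnlineLearning.iteratedLoss ℓ d T A (List.ofFn fun t => (x t, y t)) 0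
          ≤ ((φ x y : ℝ) : EReal) ∧
        ∀ (Ω : Type*) [MeasurableSpace Ω] (P : Measure Ω) [IsProbabilityMeasure P]
          (ŷ : Fin n → Ω → Y), OnlineLearning.IsRun d T A x y P ŷ →
          Integrable (fun ω => ∑ t, ℓ (ŷ t ω) (y t)) P ∧
          ∫ ω, ∑ t, ℓ (ŷ t ω) (y t) ∂P ≤ φ x y := by
  refine ⟨OnlineLearning.exists_isBurkholderStep hlsc, fun A hA x y => ?_⟩
  have hstep := hA.integrable_and_integral_le hℓ hU.concave hlsc
  have hpath : ∀ h : Fin n → Y,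
      ∑ t, ℓ (h t) (y t) ≤ φ x y + U (∑ t, T (x t) (h t) (d (h t) (y t))) := fun h => by
    linarith [hTV x h y, hU.majorizes (∑ t, T (x t) (h t) (d (h t) (y t)))]
  refine ⟨?_, fun Ω _ P _ ŷ hrun => ⟨hℓ.integrable_sum y hrun.1, ?_⟩⟩
  · refine (OnlineLearning.iteratedLoss_le hstep _ 0 (φ x y) fun h => ?_).trans
      (EReal.coe_le_coe_iff.2 ?_)
    · simpa using hpath h
    · linarith [hU.zero_le]
  · linarith [hrun.integral_sum_le hℓ hstep hpath, hU.zero_le]
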